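/- Let $\gamma\in(0,1)$. For a positive integer $N$, let $V_N=\{0,\dots,N-1\}$, and for $e=\{x,y\}$ with $x\ne y\in V_N$ let $|e|=|x-y|$. Let $\mathbb P_\gamma$ be the law of the random graph $\mathcal G_N$ with vertex set $V_N$ that contains every edge $\{x,x+1\}$ with $x,x+1\in V_N$, and that contains each of the pairs $e$ with $|e|>1$ independently of the others with probability $\exp(-|e|^\gamma)$. For a connected graph $g$ on $V_N$ with graph distance $d_g$, let $$\mathcal H_1(g)=\frac1{N^2}\sum_{x,y\in V_N}d_g(x,y).$$ (1) For every $\alpha\in(0,1)$ there exists $c>0$ such that, for every sufficiently large $N$, $$\mathbb P_\gamma\left[\mathcal H_1(\mathcal G_N)\le N^\alpha\right]\le\exp\left(-cN^{1-\alpha(1-\gamma)}\right).$$ (2) There exists $c>0$ such that, for every $N\ge2$, $$\mathbb P_\gamma\left[\mathcal H_1(\mathcal G_N)\le cN\right]\le\exp\left(-cN^{\gamma}\right).$$ Here $c$ does not depend on $N$: in (1) it may depend on $\gamma$ and $\alpha$, and in (2) on $\gamma$ only; the threshold for $N$ in (1) may depend on $\gamma$ and $\alpha$. -/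

import Mathlib

open MeasureTheory ProbabilityTheory

namespace SpatialGibbs

/-- The length `|e| = |y - x|` of an unordered pair `e = {x, y}` of elements of
`V_N = {0, …, N - 1}`. -/
def edgeLength {N : ℕ} : Sym2 (Fin N) → ℕ :=
  Sym2.lift ⟨fun x y => Nat.dist x y, fun x y => Nat.dist_comm x y⟩

/-- The pairs that are not ground edges: the unordered pairs of length greater than one. -/
abbrev LongEdge (N : ℕ) : Type := {e : Sym2 (Fin N) // 1 < edgeLength e}

/-- The set of graphs over `V_N = {0, …, N - 1}` that contain all the ground edges
`{x, x + 1}`, that is, that contain the path graph. -/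
abbrev GroundedGraph (N : ℕ) : Type := {g : SimpleGraph (Fin N) // SimpleGraph.pathGraph N ≤ g}

/-- The graph that consists of the ground edges together with the long edges `e` that are
declared open, `ω e = true`. -/
def graphOf {N : ℕ} (ω : LongEdge N → Bool) : GroundedGraph N :=
  ⟨SimpleGraph.pathGraph N ⊔
      SimpleGraph.fromEdgeSet {e | ∃ h : 1 < edgeLength e, ω ⟨e, h⟩ = true}, le_sup_left⟩

/-- The probability `exp (-|e| ^ γ)` that the pair `e` is an edge. -/
noncomputable def edgeProb {N : ℕ} (γ : ℝ) (e : Sym2 (Fin N)) : unitInterval :=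
  ⟨Real.exp (-((edgeLength e : ℝ) ^ γ)), (Real.exp_pos _).le,
    Real.exp_le_one_iff.2 (neg_nonpos.2 (Real.rpow_nonneg (Nat.cast_nonneg _) γ))⟩

/-- The law of independent indicators `ω e`, where `ω e = true` with probability
`exp (-|e| ^ γ)`. -/
noncomputable def edgeLaw (γ : ℝ) (N : ℕ) : Measure (LongEdge N → Bool) :=
  Measure.pi fun e => bernoulliMeasure true false (edgeProb γ e.1)

/-- The reference measure on the graphs containing the ground edges: the long edges are present
independently of one another, the edge `e` with probability `exp (-|e| ^ γ)`. -/
noncomputable def refMeasure (γ : ℝ) (N : ℕ) : Measure (GroundedGraph N) :=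
  (edgeLaw γ N).map graphOf

/-- Every set of graphs containing the ground edges is an event. -/
instance (N : ℕ) : DiscreteMeasurableSpace (GroundedGraph N) :=
  have : MeasurableSingletonClass (SimpleGraph (Fin N)) :=
    ⟨fun G => by
      have h : ({G} : Set (SimpleGraph (Fin N))) = SimpleGraph.Adj ⁻¹' {G.Adj} := by
        ext H
        simp
      exact h ▸ ⟨{G.Adj}, measurableSet_singleton _, rfl⟩⟩
  inferInstance

theorem measurable_graphOf {N : ℕ} : Measurable (graphOf (N := N)) :=
  measurable_of_finite _

instance (γ : ℝ) (N : ℕ) : IsProbabilityMeasure (edgeLaw γ N) := by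
  unfold edgeLaw; infer_instance

instance (γ : ℝ) (N : ℕ) : IsProbabilityMeasure (refMeasure γ N) :=
  Measure.isProbabilityMeasure_map measurable_graphOf.aemeasurable

/-- The `ℓ¹`-average path length `N⁻² ∑_{x, y ∈ V_N} d_g(x, y)`, where `d_g` is the graph
distance of `g` (which is connected, as it contains the path graph). -/
noncomputable def averagePathLength {N : ℕ} (g : GroundedGraph N) : ℝ :=
  (1 / (N : ℝ) ^ 2) * ∑ x : Fin N, ∑ y : Fin N, (g.1.dist x y : ℝ)

end SpatialGibbs

/-! Fix a scale `K` and call the ground edges `{jK, jK+1}` cut candidates. A long edge shorter than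
`K` passes over at most one candidate, so the events "no open short edge passes over candidate `j`"
depend on disjoint sets of pairs. Each has probability at least some `q > 0` that does not depend on
`K`, since `∑ k * exp (-k ^ γ)` converges. Hence, outside an event of probability exponentially
small in `N`, at least `θ * N` candidates survive (`bernoulliPi_real_card_le`).

The edges of length at least `K` are controlled through the sum of `min |e| T` over the open ones.
As `γ < 1`, the tilt `s = T ^ (γ - 1) / 2` satisfies `s * min |e| T ≤ |e| ^ γ / 2`, so it uses up at
most half of the decay of the edge probabilities. Chernoff's bound then shows that this sum exceeds
a small multiple of `N` with probability at most `exp (-c * N * T ^ (γ - 1))`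
(`edgeLaw_real_truncatedLength_ge`).

Outside both bad events, delete the candidates covered by open edges of length in `[K, T)`; a set
`R` of linear size remains, and only edges of length at least `T` jump over its elements. Give each
vertex as level the number of elements of `R` below it. All other edges change the level by at most
one, and the exceptional edges are so few that most levels are at distance at least `T` from all
their endpoints. From a vertex at such a level, every vertex whose level differs by at least `T` is
at graph distance at least `T` (`le_sum_dist`), so the average path length exceeds a constant times
`T`.

Taking `T` of order `N ^ α` gives (1), and `T` of order `N` gives (2). -/

namespace SpatialGibbs

/-! ### Exponential bounds for independent Boolean variables -/

section BernoulliProduct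

variable {ι : Type*} [Fintype ι]

/-- The law of independent Boolean variables, where the variable `e` is `true` with
probability `p e`. -/
noncomputable abbrev bernoulliPi (p : ι → unitInterval) : Measure (ι → Bool) :=
  Measure.pi fun e => bernoulliMeasure true false (p e)

theorem integral_bernoulli_bool (p : unitInterval) (f : Bool → ℝ) :
    ∫ b, f b ∂(bernoulliMeasure true false p) = p * f true + (1 - p) * f false := by
  rw [integral_fintype (.of_finite)]
  simp

theorem integral_exp_sum_bernoulliPi (p : ι → unitInterval) (a : ι → ℝ) :
    ∫ ω, Real.exp (∑ e, if ω e = true then a e else 0) ∂(bernoulliPi p)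
      = ∏ e, (1 + (p e : ℝ) * (Real.exp (a e) - 1)) := by
  simp_rw [Real.exp_sum]
  rw [integral_fintype_prod_eq_prod
    (f := fun e (b : Bool) => Real.exp (if b = true then a e else 0))]
  refine Finset.prod_congr rfl fun e _ => ?_
  rw [integral_bernoulli_bool]
  simp
  ring

theorem real_le_exp_integral {Ω : Type*} [MeasurableSpace Ω] {μ : Measure Ω} [IsFiniteMeasure μ]
    [Finite Ω] [DiscreteMeasurableSpace Ω] (f : Ω → ℝ) (t : ℝ) :
    μ.real {ω | t ≤ f ω} ≤ Real.exp (-t) * ∫ ω, Real.exp (f ω) ∂μ := by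
  have h := measure_ge_le_exp_mul_mgf (μ := μ) (X := f) (t := 1) t zero_le_one .of_finite
  simpa [mgf] using h

/-- Chernoff's bound for a weighted sum of independent indicators. -/
theorem bernoulliPi_real_le_sum (p : ι → unitInterval) (a : ι → ℝ) (t : ℝ) :
    (bernoulliPi p).real {ω | t ≤ ∑ e, if ω e = true then a e else 0}
      ≤ Real.exp (-t + ∑ e, (p e : ℝ) * (Real.exp (a e) - 1)) := by
  refine (real_le_exp_integral _ t).trans ?_
  rw [integral_exp_sum_bernoulliPi, Real.exp_add, Real.exp_sum]
  gcongr with e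
  · intro e _
    have h1 := (p e).2.1
    have h2 := (p e).2.2
    nlinarith [Real.exp_pos (a e)]
  · linarith [Real.add_one_le_exp ((p e : ℝ) * (Real.exp (a e) - 1))]

theorem bernoulliPi_real_forall_false [DecidableEq ι] (p : ι → unitInterval) (S : Finset ι) :
    (bernoulliPi p).real {ω | ∀ e ∈ S, ω e = false} = ∏ e ∈ S, (1 - (p e : ℝ)) := by
  have h : {ω : ι → Bool | ∀ e ∈ S, ω e = false}
      = Set.pi Set.univ fun e => if e ∈ S then {false} else Set.univ := by
    ext ω
    simp only [Set.mem_ofPred_eq, Set.mem_pi, Set.mem_univ, true_imp_iff]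
    refine forall_congr' fun e => ?_
    split_ifs with he <;> simp [he]
  rw [h, measureReal_def, Measure.pi_pi, ENNReal.toReal_prod, ← Finset.prod_filter_mul_prod_filter_not
    Finset.univ (· ∈ S)]
  rw [Finset.prod_congr rfl (g := fun e => 1 - (p e : ℝ)),
    Finset.prod_congr (s₁ := Finset.univ.filter (· ∉ S)) rfl (g := fun e => (1 : ℝ))]
  · simp
  · intro e he
    simp [(Finset.mem_filter.1 he).2]
  · intro e he
    simp [(Finset.mem_filter.1 he).2, unitInterval.coe_symm_eq, unitInterval.toNNReal]
    rfl

/-- Among disjoint sets of indices, each of which carries no `true` with probability at least `q`,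
it is exponentially unlikely that fewer than a fraction `q / 4` carry no `true`. -/
theorem bernoulliPi_real_card_le [DecidableEq ι] (p : ι → unitInterval) {J : ℕ}
    (S : Fin J → Finset ι) (hS : Pairwise fun i j => Disjoint (S i) (S j)) {q : ℝ}
    (hq : ∀ j, q ≤ ∏ e ∈ S j, (1 - (p e : ℝ))) :
    (bernoulliPi p).real
        {ω | ((Finset.univ.filter fun j => ∀ e ∈ S j, ω e = false).card : ℝ) ≤ q * J / 4}
      ≤ Real.exp (-(q * J / 4)) := by
  set μ := bernoulliPi p
  let A : Fin J → Set (ι → Bool) := fun j => {ω | ∀ e ∈ S j, ω e = false}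
  -- Chernoff's bound for the lower tail: `φ j` is `exp (-1)` on `A j` and `1` elsewhere, so its
  -- mean is at most `1 - q / 2 ≤ exp (-(q / 2))`. Markov's inequality loses `exp (q * J / 4)`
  -- against `exp (-(q * J / 2))`.
  let φ : Fin J → (ι → Bool) → ℝ := fun j ω =>
    Real.exp (if ∀ e ∈ S j, ω e = false then -1 else 0)
  have hφ : ∀ j ω, φ j ω = 1 - (A j).indicator (fun _ => 1) ω * (1 - Real.exp (-1)) := by
    intro j ω
    by_cases h : ∀ e ∈ S j, ω e = false
    · have h' : ω ∈ A j := h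
      simp only [φ, if_pos h, Set.indicator_of_mem h']
      ring
    · have h' : ω ∉ A j := h
      simp only [φ, if_neg h, Set.indicator_of_notMem h']
      simp
  -- An intersection of the `A j` is an event of the same form for the union of the sets `S j`, and
  -- disjointness factors its probability.
  have hA : iIndepSet A μ := by
    rw [iIndepSet_iff_meas_biInter fun j => (Set.toFinite _).measurableSet]
    intro s
    have h1 : ⋂ j ∈ s, A j = {ω | ∀ e ∈ s.biUnion S, ω e = false} := by
      ext ω
      simp only [A, Set.mem_iInter, Set.mem_ofPred_eq, Finset.mem_biUnion]
      exact ⟨fun h e ⟨j, hj, he⟩ => h j hj e he, fun h j hj e he => h e ⟨j, hj, he⟩⟩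
    rw [h1, ← ENNReal.toReal_eq_toReal_iff' (measure_ne_top _ _)
      (ENNReal.prod_ne_top fun j _ => measure_ne_top _ _), ENNReal.toReal_prod]
    refine (bernoulliPi_real_forall_false p _).trans ?_
    rw [Finset.prod_biUnion fun i _ j _ hij => hS hij]
    exact Finset.prod_congr rfl fun j _ => (bernoulliPi_real_forall_false p _).symm
  have hind : iIndepFun φ μ := by
    have := (hA.iIndepFun_indicator (β := ℝ)).comp (fun _ x => 1 - x * (1 - Real.exp (-1)))
      fun _ => by fun_prop
    convert this using 2 with j
    exact funext (hφ j)
  have hint := hind.integral_fun_prod_eq_prod_integral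
    (fun j => (measurable_of_finite _).aestronglyMeasurable)
  have hfac : ∀ j, ∫ ω, φ j ω ∂μ ≤ Real.exp (-(q / 2)) := by
    intro j
    simp_rw [hφ]
    rw [integral_sub .of_finite .of_finite, integral_mul_const,
      integral_indicator_const _ (Set.toFinite _).measurableSet, bernoulliPi_real_forall_false]
    have h2 := hq j
    have h3 : Real.exp (-1) ≤ 1 / 2 := by
      have := Real.exp_one_gt_d9
      rw [Real.exp_neg, ← one_div]
      exact one_div_le_one_div_of_le (by norm_num) (by linarith)
    have h4 := Real.add_one_le_exp (-(q / 2))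
    have h5 : 0 ≤ ∏ e ∈ S j, (1 - (p e : ℝ)) :=
      Finset.prod_nonneg fun e _ => sub_nonneg.2 (p e).2.2
    simp only [integral_const, probReal_univ, smul_eq_mul]
    nlinarith
  have hset : {ω : ι → Bool |
      ((Finset.univ.filter fun j => ∀ e ∈ S j, ω e = false).card : ℝ) ≤ q * J / 4}
      = {ω | -(q * J / 4) ≤ ∑ j, if ∀ e ∈ S j, ω e = false then (-1 : ℝ) else 0} := by
    ext ω
    simp only [Set.mem_ofPred_eq, Finset.card_filter]
    push_cast
    rw [← neg_le_neg_iff, ← Finset.sum_neg_distrib]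
    refine Iff.of_eq (congrArg _ (Finset.sum_congr rfl fun j _ => ?_))
    split_ifs <;> simp
  rw [hset]
  refine (real_le_exp_integral _ _).trans ?_
  have h6 : ∫ ω, Real.exp (∑ j, if ∀ e ∈ S j, ω e = false then (-1 : ℝ) else 0) ∂μ
      ≤ Real.exp (-(q / 2)) ^ J := by
    simp_rw [Real.exp_sum]
    refine (le_of_eq hint).trans ?_
    refine (Finset.prod_le_prod (fun j _ => integral_nonneg fun ω => (Real.exp_pos _).le)
      fun j _ => hfac j).trans ?_
    simp
  refine (mul_le_mul_of_nonneg_left h6 (Real.exp_pos _).le).trans ?_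
  rw [← Real.exp_nat_mul, ← Real.exp_add]
  apply Real.exp_le_exp.2
  linarith

end BernoulliProduct

/-! ### Graph distance bounded below through levels -/

section Deterministic

/-- Follow a shortest walk: each step raises `f` by at most one. -/
theorem le_add_dist_of_adj {V : Type*} {G : SimpleGraph V} {f : V → ℕ}
    (hf : ∀ u v, G.Adj u v → f v ≤ f u + 1) {u v : V} (h : G.Reachable u v) :
    f v ≤ f u + G.dist u v := by
  obtain ⟨w, hw⟩ := h.exists_walk_length_eq_dist
  rw [← hw]
  clear hw
  induction w with
  | nil => simp
  | cons hadj w ih =>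
    have := hf _ _ hadj
    have := ih w.reachable
    rw [SimpleGraph.Walk.length_cons]
    omega

theorem GroundedGraph.reachable {N : ℕ} (g : GroundedGraph N) (x y : Fin N) :
    g.1.Reachable x y :=
  (SimpleGraph.pathGraph_preconnected N x y).mono g.2

/-- The number of elements of `R` below `v`. -/
def countBelow (R : Finset ℕ) (v : ℕ) : ℕ := (R.filter (· < v)).card

theorem countBelow_zero (R : Finset ℕ) : countBelow R 0 = 0 := by simp [countBelow]

theorem countBelow_mono (R : Finset ℕ) : Monotone (countBelow R) := fun u v h =>
  Finset.card_le_card fun i hi => by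
    simp only [Finset.mem_filter] at hi ⊢
    exact ⟨hi.1, hi.2.trans_le h⟩

theorem countBelow_succ_le (R : Finset ℕ) (v : ℕ) : countBelow R (v + 1) ≤ countBelow R v + 1 := by
  have : R.filter (· < v + 1) ⊆ insert v (R.filter (· < v)) := fun i hi => by
    simp only [Finset.mem_filter, Finset.mem_insert] at hi ⊢
    by_cases h : i = v
    · exact .inl h
    · exact .inr ⟨hi.1, by omega⟩
  exact (Finset.card_le_card this).trans (Finset.card_insert_le _ _)

theorem countBelow_eq_of_forall_notMem {R : Finset ℕ} {u v : ℕ} (h : u ≤ v)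
    (hR : ∀ i ∈ R, u ≤ i → ¬ i < v) : countBelow R v = countBelow R u := by
  refine congrArg Finset.card (Finset.filter_congr fun i hi => ?_)
  have := hR i hi
  omega

theorem exists_countBelow_eq (R : Finset ℕ) (v r : ℕ) (hr : r ≤ countBelow R v) :
    ∃ u ≤ v, countBelow R u = r := by
  induction v with
  | zero => exact ⟨0, le_rfl, by rw [countBelow_zero] at hr ⊢; omega⟩
  | succ v ih =>
    by_cases h : r ≤ countBelow R v
    · obtain ⟨u, hu, h⟩ := ih h
      exact ⟨u, by omega, h⟩
    · exact ⟨v + 1, le_rfl, by have := countBelow_succ_le R v; omega⟩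

theorem exists_fin_countBelow_eq {N : ℕ} {R : Finset ℕ} (hR : ∀ i ∈ R, i + 1 < N) (hN : 0 < N)
    {r : ℕ} (hr : r ≤ R.card) : ∃ v : Fin N, countBelow R v = r := by
  have : countBelow R (N - 1) = R.card := by
    refine congrArg Finset.card (Finset.filter_true_of_mem fun i hi => ?_)
    have := hR i hi
    omega
  obtain ⟨u, hu, h⟩ := exists_countBelow_eq R (N - 1) r (this ▸ hr)
  exact ⟨⟨u, by omega⟩, h⟩

theorem card_filter_dist_lt_le (s : Finset ℕ) (z T : ℕ) :
    (s.filter fun r => Nat.dist r z < T).card ≤ 2 * T := by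
  have : (s.filter fun r => Nat.dist r z < T) ⊆ Finset.Ico (z + 1 - T) (z + T) := fun r hr => by
    obtain ⟨-, hr⟩ := Finset.mem_filter.1 hr
    rw [Nat.dist] at hr
    rw [Finset.mem_Ico]
    omega
  refine (Finset.card_le_card this).trans ?_
  rw [Nat.card_Ico]
  omega

/-- If each edge of a graph crosses at most one element of `R`, apart from the edges whose endpoints
have their `R`-levels in `Z`, then the distances sum up to a large quantity. -/
theorem le_sum_dist {N : ℕ} (g : GroundedGraph N) (hN : 0 < N) {R Z : Finset ℕ} (T : ℕ)
    (hR : ∀ i ∈ R, i + 1 < N)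
    (hadj : ∀ u v : Fin N, g.1.Adj u v → u < v →
      countBelow R v ≤ countBelow R u + 1 ∨ (countBelow R u ∈ Z ∧ countBelow R v ∈ Z)) :
    (R.card - Z.card * (2 * T)) * (R.card - 2 * T) * T ≤ ∑ x, ∑ y, g.1.dist x y := by
  classical
  have hdist : ∀ x y : Fin N, (∀ z ∈ Z, T ≤ Nat.dist (countBelow R x) z) →
      T ≤ Nat.dist (countBelow R y) (countBelow R x) → T ≤ g.1.dist x y := by
    intro x y hx hxy
    -- Truncation at `T` makes `f` a 1-Lipschitz function even across the exceptional edges: their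
    -- endpoints have levels in `Z`, far from that of `x`, so `f` equals `T` at both.
    let f : Fin N → ℕ := fun v => min T (Nat.dist (countBelow R v) (countBelow R x))
    have hstep : ∀ u v, g.1.Adj u v → u < v → f v ≤ f u + 1 ∧ f u ≤ f v + 1 := by
      intro u v huv hlt
      have hm := countBelow_mono R hlt.le
      rcases hadj u v huv hlt with h | ⟨h1, h2⟩
      · simp only [f, Nat.dist]
        omega
      · have h3 := hx _ h1
        have h4 := hx _ h2
        simp only [f, Nat.dist] at h3 h4 ⊢
        omega
    have hf : ∀ u v, g.1.Adj u v → f v ≤ f u + 1 := by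
      intro u v huv
      rcases lt_trichotomy u v with h | h | h
      · exact (hstep u v huv h).1
      · exact absurd h huv.ne
      · exact (hstep v u huv.symm h).2
    have h := le_add_dist_of_adj hf (g.reachable x y)
    have h1 : f x = 0 := by simp [f]
    have h2 : f y = T := by simp [f, hxy]
    omega
  -- Every level from `0` to `R.card` is attained, so counting levels bounds the number of vertices
  -- from below.
  have hex : ∀ r : Fin (R.card + 1), ∃ v : Fin N, countBelow R v = r := fun r =>
    exists_fin_countBelow_eq hR hN (Nat.lt_succ_iff.1 r.2)
  choose w hw using hex
  have hwinj : Function.Injective w := fun r s h => Fin.ext (by rw [← hw, ← hw, h])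
  let A : Finset (Fin N) := Finset.univ.filter fun x =>
    (∀ z ∈ Z, T ≤ Nat.dist (countBelow R x) z)
  let B : Fin N → Finset (Fin N) := fun x => Finset.univ.filter fun y =>
    T ≤ Nat.dist (countBelow R y) (countBelow R x)
  have hcount : ∀ P : ℕ → Prop, ∀ [DecidablePred P],
      ((Finset.range (R.card + 1)).filter P).card
        ≤ (Finset.univ.filter fun x : Fin N => P (countBelow R x)).card := by
    intro P _
    refine Finset.card_le_card_of_injOn
      (fun r => if h : r < R.card + 1 then w ⟨r, h⟩ else ⟨0, hN⟩) ?_ ?_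
    · intro r hr
      simp only [Finset.coe_filter, Finset.mem_range, Set.mem_ofPred_eq] at hr
      simp [hr.1, hw, hr.2]
    · intro r hr s hs h
      simp only [Finset.coe_filter, Finset.mem_range, Set.mem_ofPred_eq] at hr hs
      simp only [hr.1, hs.1, dif_pos] at h
      simpa using hwinj h
  have hA : R.card - Z.card * (2 * T) ≤ A.card := by
    refine le_trans ?_ (hcount fun r => ∀ z ∈ Z, T ≤ Nat.dist r z)
    have h1 := Finset.card_filter_add_card_filter_not (s := Finset.range (R.card + 1))
      (fun r => ∀ z ∈ Z, T ≤ Nat.dist r z)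
    have h2 : ((Finset.range (R.card + 1)).filter fun r => ¬ ∀ z ∈ Z, T ≤ Nat.dist r z).card
        ≤ Z.card * (2 * T) := by
      have : ((Finset.range (R.card + 1)).filter fun r => ¬ ∀ z ∈ Z, T ≤ Nat.dist r z)
          ⊆ Z.biUnion fun z => (Finset.range (R.card + 1)).filter fun r => Nat.dist r z < T := by
        intro r hr
        simp only [Finset.mem_filter, not_forall, not_le, Finset.mem_biUnion] at hr ⊢
        obtain ⟨hr, z, hz, h⟩ := hr
        exact ⟨z, hz, hr, h⟩
      exact (Finset.card_le_card this).trans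
        (Finset.card_biUnion_le_card_mul _ _ _ fun z _ => card_filter_dist_lt_le _ _ _)
    rw [Finset.card_range] at h1
    omega
  have hB : ∀ x, R.card - 2 * T ≤ (B x).card := by
    intro x
    refine le_trans ?_ (hcount fun r => T ≤ Nat.dist r (countBelow R x))
    have h1 := Finset.card_filter_add_card_filter_not (s := Finset.range (R.card + 1))
      (fun r => T ≤ Nat.dist r (countBelow R x))
    have h2 := card_filter_dist_lt_le (Finset.range (R.card + 1)) (countBelow R x) T
    simp only [not_le, Finset.card_range] at h1
    omega
  calc (R.card - Z.card * (2 * T)) * (R.card - 2 * T) * T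
      ≤ A.card * ((R.card - 2 * T) * T) := by
        rw [mul_assoc]
        exact Nat.mul_le_mul_right _ hA
    _ = ∑ x ∈ A, (R.card - 2 * T) * T := by rw [Finset.sum_const, smul_eq_mul]
    _ ≤ ∑ x ∈ A, ∑ y, g.1.dist x y := by
        refine Finset.sum_le_sum fun x hx => ?_
        calc (R.card - 2 * T) * T ≤ (B x).card * T := Nat.mul_le_mul_right _ (hB x)
          _ = ∑ y ∈ B x, T := by rw [Finset.sum_const, smul_eq_mul]
          _ ≤ ∑ y ∈ B x, g.1.dist x y := Finset.sum_le_sum fun y hy =>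
              hdist x y (Finset.mem_filter.1 hx).2 (Finset.mem_filter.1 hy).2
          _ ≤ ∑ y, g.1.dist x y := Finset.sum_le_sum_of_subset (Finset.subset_univ _)
    _ ≤ ∑ x, ∑ y, g.1.dist x y := Finset.sum_le_sum_of_subset (Finset.subset_univ _)

/-- Distinct vertices are at distance at least one. This settles the finitely many small `N` in (2).
-/
theorem half_le_averagePathLength {N : ℕ} (hN : 2 ≤ N) (g : GroundedGraph N) :
    1 / 2 ≤ averagePathLength g := by
  have h1 : ∀ x : Fin N, (N : ℝ) - 1 ≤ ∑ y, (g.1.dist x y : ℝ) := by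
    intro x
    calc (N : ℝ) - 1 = ∑ y ∈ Finset.univ.erase x, (1 : ℝ) := by
          rw [Finset.sum_const, Finset.card_erase_of_mem (Finset.mem_univ x), Finset.card_univ,
            Fintype.card_fin, nsmul_eq_mul, mul_one, Nat.cast_sub (by omega), Nat.cast_one]
      _ ≤ ∑ y ∈ Finset.univ.erase x, (g.1.dist x y : ℝ) := by
          refine Finset.sum_le_sum fun y hy => ?_
          exact_mod_cast (g.reachable x y).pos_dist_of_ne (Finset.ne_of_mem_erase hy).symm
      _ ≤ ∑ y, (g.1.dist x y : ℝ) := Finset.sum_le_sum_of_subset_of_nonneg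
          (Finset.subset_univ _) fun _ _ _ => Nat.cast_nonneg _
  have h2 : (N : ℝ) * (N - 1) ≤ ∑ x : Fin N, ∑ y : Fin N, (g.1.dist x y : ℝ) := by
    calc (N : ℝ) * (N - 1) = ∑ x : Fin N, ((N : ℝ) - 1) := by
          rw [Finset.sum_const, Finset.card_univ, Fintype.card_fin, nsmul_eq_mul]
      _ ≤ _ := Finset.sum_le_sum fun x _ => h1 x
  have h3 : (2 : ℝ) ≤ N := by exact_mod_cast hN
  rw [averagePathLength, one_div_mul_eq_div, le_div_iff₀ (by positivity)]
  nlinarith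

end Deterministic

/-! ### Long edges and the good event -/

section LongEdges

variable {N : ℕ}

/-- The length of a long edge. -/
def LongEdge.len (e : LongEdge N) : ℕ := edgeLength e.1

/-- The left endpoint of a long edge. -/
def LongEdge.lo (e : LongEdge N) : ℕ := (Sym2.inf e.1 : Fin N)

theorem edgeLength_mk (u v : Fin N) : edgeLength s(u, v) = Nat.dist u v := rfl

theorem inf_add_edgeLength (e : Sym2 (Fin N)) : (e.inf : ℕ) + edgeLength e = e.sup := by
  induction e with | _ u v
  rw [edgeLength_mk, Sym2.inf_mk, Sym2.sup_mk, Nat.dist]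
  rcases le_total u v with h | h
  · have : (u : ℕ) ≤ v := h
    simp only [inf_eq_left.2 h, sup_eq_right.2 h]
    omega
  · have : (v : ℕ) ≤ u := h
    simp only [inf_eq_right.2 h, sup_eq_left.2 h]
    omega

theorem LongEdge.lo_add_len_lt (e : LongEdge N) : e.lo + e.len < N :=
  (inf_add_edgeLength e.1).symm ▸ (Sym2.sup e.1).2

theorem LongEdge.two_le_len (e : LongEdge N) : 2 ≤ e.len := e.2

theorem LongEdge.ext_lo_len {e f : LongEdge N} (h₁ : e.lo = f.lo) (h₂ : e.len = f.len) : e = f := by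
  refine Subtype.ext (Sym2.inf_eq_inf_and_sup_eq_sup.1 ⟨Fin.ext h₁, Fin.ext ?_⟩)
  rw [← inf_add_edgeLength, ← inf_add_edgeLength]
  exact congrArg₂ (· + ·) h₁ h₂

/-- For each length there are at most `N` left endpoints. -/
theorem sum_longEdge_le (F : ℕ → ℝ) (hF : ∀ k, 0 ≤ F k) :
    ∑ e : LongEdge N, F e.len ≤ N * ∑ k ∈ Finset.range N, F k := by
  have h : N * ∑ k ∈ Finset.range N, F k
      = ∑ x ∈ Finset.range N ×ˢ Finset.range N, F x.2 := by
    simp only [Finset.sum_product, Finset.sum_const, Finset.card_range, nsmul_eq_mul]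
  rw [h]
  have hinj : Function.Injective fun e : LongEdge N => (e.lo, e.len) := fun e f h =>
    LongEdge.ext_lo_len (congrArg Prod.fst h) (congrArg Prod.snd h)
  have := Finset.sum_image (s := (Finset.univ : Finset (LongEdge N)))
    (f := fun x : ℕ × ℕ => F x.2) hinj.injOn
  rw [← this]
  refine Finset.sum_le_sum_of_subset_of_nonneg ?_ fun _ _ _ => hF _
  intro x hx
  obtain ⟨e, -, rfl⟩ := Finset.mem_image.1 hx
  have := e.lo_add_len_lt
  simp only [Finset.mem_product, Finset.mem_range]
  omega

/-- At most `k` pairs of length `k` pass over a given ground edge, one for each value of `i - e.lo <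
k`. -/
theorem sum_longEdge_cover_le (F : ℕ → ℝ) (hF : ∀ k, 0 ≤ F k) (i : ℕ) (S : Finset (LongEdge N))
    (hS : ∀ e ∈ S, e.lo ≤ i ∧ i < e.lo + e.len) :
    ∑ e ∈ S, F e.len ≤ ∑ k ∈ Finset.range N, k * F k := by
  have h : ∑ k ∈ Finset.range N, k * F k
      = ∑ x ∈ (Finset.range N).sigma fun k => Finset.range k, F x.1 := by
    rw [Finset.sum_sigma]
    simp
  rw [h]
  have hinj : Set.InjOn (fun e : LongEdge N => (⟨e.len, i - e.lo⟩ : Σ _ : ℕ, ℕ)) S := by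
    intro e he f hf h
    have h1 := hS e he
    have h2 := hS f hf
    simp only [Sigma.mk.injEq, heq_eq_eq] at h
    exact LongEdge.ext_lo_len (by omega) h.1
  have := Finset.sum_image (f := fun x : Σ _ : ℕ, ℕ => F x.1) hinj
  rw [← this]
  refine Finset.sum_le_sum_of_subset_of_nonneg ?_ fun _ _ _ => hF _
  intro x hx
  obtain ⟨e, he, rfl⟩ := Finset.mem_image.1 hx
  have h1 := e.lo_add_len_lt
  have h2 := hS e he
  simp only [Finset.mem_sigma, Finset.mem_range]
  omega

/-- The long edges shorter than `K` that pass over the ground edge `{j * K, j * K + 1}`. -/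
def shortEdges (N K : ℕ) (j : Fin (N / K)) : Finset (LongEdge N) :=
  Finset.univ.filter fun e => e.len < K ∧ e.lo ≤ j * K ∧ j * K < e.lo + e.len

/-- Passing over two distinct multiples of `K` requires length greater than `K`. -/
theorem disjoint_shortEdges (N K : ℕ) :
    Pairwise fun i j => Disjoint (shortEdges N K i) (shortEdges N K j) := by
  have : ∀ i j : Fin (N / K), i < j → Disjoint (shortEdges N K i) (shortEdges N K j) := by
    intro i j hij
    refine Finset.disjoint_left.2 fun e hi hj => ?_
    obtain ⟨-, h1, h2, h3⟩ := Finset.mem_filter.1 hi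
    obtain ⟨-, -, h4, h5⟩ := Finset.mem_filter.1 hj
    have h6 : ((i : ℕ) + 1) * K ≤ j * K := Nat.mul_le_mul_right _ hij
    rw [add_mul] at h6
    omega
  intro i j hij
  rcases hij.lt_or_gt with h | h
  · exact this i j h
  · exact (this j i h).symm

/-- The sum of `min |e| T` over the open edges `e` of length at least `K`. -/
noncomputable def truncatedLength (K T : ℕ) (ω : LongEdge N → Bool) : ℝ :=
  ∑ e, if ω e = true then (if K ≤ e.len then (min e.len T : ℝ) else 0) else 0

/-- The truncated length pays for both kinds of damage: medium edges (`M`) delete at most their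
total length from the candidates `I`, and each very long edge (`L`) contributes `T` to the sum while
spoiling the levels within `T` of its two endpoints. -/
theorem lt_averagePathLength_graphOf {K T : ℕ} (hK : 2 ≤ K) (hT : 1 ≤ T) (hN : 0 < N) {θ : ℝ}
    (hθ : 0 < θ) (hTN : (T : ℝ) ≤ θ * N / 4) (ω : LongEdge N → Bool)
    (hω : truncatedLength K T ω ≤ θ / 8 * N)
    (hb : θ * N ≤ (Finset.univ.filter fun j => ∀ e ∈ shortEdges N K j, ω e = false).card) :
    θ ^ 2 / 8 * T < averagePathLength (graphOf ω) := by
  classical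
  set b : Finset (Fin (N / K)) :=
    Finset.univ.filter fun j => ∀ e ∈ shortEdges N K j, ω e = false
  let I : Finset ℕ := b.image fun j : Fin (N / K) => (j : ℕ) * K
  let M : Finset (LongEdge N) := Finset.univ.filter fun e => ω e = true ∧ K ≤ e.len ∧ e.len < T
  let L : Finset (LongEdge N) := Finset.univ.filter fun e => ω e = true ∧ K ≤ e.len ∧ T ≤ e.len
  let D : Finset ℕ := M.biUnion fun e => Finset.Ico e.lo (e.lo + e.len)
  let R : Finset ℕ := I \ D
  let Z : Finset ℕ := L.biUnion fun e => {countBelow R e.lo, countBelow R (e.lo + e.len)}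
  have hI : I.card = b.card := Finset.card_image_of_injective _ fun i j h =>
    Fin.ext (Nat.eq_of_mul_eq_mul_right (by omega) h)
  have hD : D.card ≤ ∑ e ∈ M, e.len := by
    refine Finset.card_biUnion_le.trans (le_of_eq (Finset.sum_congr rfl fun e _ => ?_))
    rw [Nat.card_Ico]
    omega
  have hZ : Z.card ≤ L.card * 2 := Finset.card_biUnion_le_card_mul _ _ _ fun e _ =>
    Finset.card_le_two
  have hX : ((∑ e ∈ M, e.len : ℕ) : ℝ) + L.card * T ≤ truncatedLength K T ω := by
    have hdisj : Disjoint M L := Finset.disjoint_left.2 fun e h1 h2 => by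
      have h1 := (Finset.mem_filter.1 h1).2.2.2
      have h2 := (Finset.mem_filter.1 h2).2.2.2
      omega
    rw [truncatedLength]
    calc ((∑ e ∈ M, e.len : ℕ) : ℝ) + L.card * T
        = (∑ e ∈ M, if ω e = true then (if K ≤ e.len then (min e.len T : ℝ) else 0) else 0)
          + ∑ e ∈ L, if ω e = true then (if K ≤ e.len then (min e.len T : ℝ) else 0) else 0 := by
          push_cast
          congr 1
          · refine Finset.sum_congr rfl fun e he => ?_
            obtain ⟨-, h1, h2, h3⟩ := Finset.mem_filter.1 he
            rw [if_pos h1, if_pos h2, min_eq_left (by exact_mod_cast h3.le)]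
          · rw [← nsmul_eq_mul, ← Finset.sum_const]
            refine Finset.sum_congr rfl fun e he => ?_
            obtain ⟨-, h1, h2, h3⟩ := Finset.mem_filter.1 he
            rw [if_pos h1, if_pos h2, min_eq_right (by exact_mod_cast h3)]
      _ = ∑ e ∈ M ∪ L, if ω e = true then (if K ≤ e.len then (min e.len T : ℝ) else 0) else 0 :=
          (Finset.sum_union hdisj).symm
      _ ≤ _ := Finset.sum_le_sum_of_subset_of_nonneg (Finset.subset_univ _) fun _ _ _ => by
          positivity
  have hcover : ∀ i ∈ R, ∀ e : LongEdge N, ω e = true → e.lo ≤ i → i < e.lo + e.len → e ∈ L := by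
    intro i hi e he h1 h2
    obtain ⟨hi, hiD⟩ := Finset.mem_sdiff.1 hi
    obtain ⟨j, hj, rfl⟩ := Finset.mem_image.1 hi
    have h3 : K ≤ e.len := by
      by_contra h3
      have := (Finset.mem_filter.1 hj).2 e
        (Finset.mem_filter.2 ⟨Finset.mem_univ _, not_le.1 h3, h1, h2⟩)
      simp [this] at he
    refine Finset.mem_filter.2 ⟨Finset.mem_univ _, he, h3, ?_⟩
    by_contra h4
    exact hiD (Finset.mem_biUnion.2 ⟨e, Finset.mem_filter.2 ⟨Finset.mem_univ _, he, h3, not_le.1 h4⟩,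
      Finset.mem_Ico.2 ⟨h1, h2⟩⟩)
  -- `j * K + K ≤ N` gives a strict inequality because `K ≥ 2`.
  have hR : ∀ i ∈ R, i + 1 < N := by
    intro i hi
    obtain ⟨j, -, rfl⟩ := Finset.mem_image.1 (Finset.mem_sdiff.1 hi).1
    have h1 : ((j : ℕ) + 1) * K ≤ N / K * K := Nat.mul_le_mul_right _ j.2
    have h2 := Nat.div_mul_le_self N K
    rw [add_mul] at h1
    omega
  have hadj : ∀ u v : Fin N, (graphOf ω).1.Adj u v → u < v →
      countBelow R v ≤ countBelow R u + 1 ∨ (countBelow R u ∈ Z ∧ countBelow R v ∈ Z) := by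
    intro u v huv hlt
    have hlt' : (u : ℕ) < v := hlt
    rcases huv with h | h
    · rw [SimpleGraph.pathGraph_adj] at h
      have : (v : ℕ) = u + 1 := by omega
      exact .inl (this ▸ countBelow_succ_le R u)
    · obtain ⟨⟨h1, h2⟩, -⟩ := (SimpleGraph.fromEdgeSet_adj _).1 h
      let e : LongEdge N := ⟨s(u, v), h1⟩
      have hlo : e.lo = u := by simp [e, LongEdge.lo, hlt.le]
      have hhi : e.lo + e.len = v := by
        refine (inf_add_edgeLength s(u, v)).trans ?_
        simp [hlt.le]
      by_cases hc : ∀ i ∈ R, (u : ℕ) ≤ i → ¬ i < v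
      · exact .inl ((countBelow_eq_of_forall_notMem hlt'.le hc).le.trans (Nat.le_succ _))
      · push Not at hc
        obtain ⟨i, hi, hi1, hi2⟩ := hc
        have he := hcover i hi e h2 (hlo ▸ hi1) (hhi ▸ hi2)
        refine .inr ⟨Finset.mem_biUnion.2 ⟨e, he, ?_⟩, Finset.mem_biUnion.2 ⟨e, he, ?_⟩⟩
        · simp [hlo]
        · simp [hhi]
  have hmain := le_sum_dist (graphOf ω) hN T hR hadj
  have hRcard : I.card ≤ R.card + D.card := by
    have : I.card - D.card ≤ R.card := Finset.le_card_sdiff D I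
    omega
  have hNR : (0 : ℝ) < N := by exact_mod_cast hN
  have hTR : (1 : ℝ) ≤ T := by exact_mod_cast hT
  have hsub : ∀ a b : ℕ, (a : ℝ) - b ≤ ((a - b : ℕ) : ℝ) := fun a b => by
    rw [sub_le_iff_le_add]
    have : a ≤ a - b + b := by omega
    exact_mod_cast this
  have hD' : (D.card : ℝ) ≤ (∑ e ∈ M, e.len : ℕ) := by exact_mod_cast hD
  have hZ' : (Z.card : ℝ) ≤ L.card * 2 := by exact_mod_cast hZ
  have hRcard' : (b.card : ℝ) ≤ R.card + D.card := by exact_mod_cast hI ▸ hRcard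
  have hM0 : (0 : ℝ) ≤ (∑ e ∈ M, e.len : ℕ) := Nat.cast_nonneg _
  have hLT : (0 : ℝ) ≤ L.card * T := by positivity
  have hZT : (Z.card : ℝ) * T ≤ L.card * 2 * T := by gcongr
  -- With `m` the total length of `M`, the loss from `θ * N` is at most `m + 4 * L.card * T ≤ θ * N
  -- / 2`. In the next bound it is at most `θ * N / 8 + θ * N / 2`, whence the common factor `3 /
  -- 8`, whose square `9 / 64` exceeds `1 / 8`.
  have h1 : 3 / 8 * θ * N ≤ ((R.card - Z.card * (2 * T) : ℕ) : ℝ) := by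
    refine le_trans ?_ (hsub _ _)
    push_cast
    nlinarith
  have h2 : 3 / 8 * θ * N ≤ ((R.card - 2 * T : ℕ) : ℝ) := by
    refine le_trans ?_ (hsub _ _)
    push_cast
    nlinarith
  have h3 : 3 / 8 * θ * N * (3 / 8 * θ * N) * T
      ≤ ∑ x : Fin N, ∑ y : Fin N, ((graphOf ω).1.dist x y : ℝ) := by
    calc 3 / 8 * θ * N * (3 / 8 * θ * N) * T
        ≤ ((R.card - Z.card * (2 * T) : ℕ) : ℝ) * ((R.card - 2 * T : ℕ) : ℝ) * T := by gcongr
      _ ≤ _ := by exact_mod_cast hmain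
  rw [averagePathLength, one_div_mul_eq_div, lt_div_iff₀ (by positivity)]
  refine lt_of_lt_of_le ?_ h3
  have : 0 < θ ^ 2 * N ^ 2 * T := by positivity
  nlinarith

end LongEdges

/-! ### Estimates for the edge probabilities -/

section Estimates

theorem summable_pow_mul_exp_neg_rpow {γ : ℝ} (hγ : 0 < γ) {b : ℝ} (hb : 0 < b) (m : ℕ) :
    Summable fun k : ℕ => (k : ℝ) ^ m * Real.exp (-(b * (k : ℝ) ^ γ)) := by
  -- This exponent, applied to `k ^ γ`, gives `k ^ (-(m + 2))`, so the terms are dominated by `1 / k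
  -- ^ 2`.
  have h1 := (isLittleO_exp_neg_mul_rpow_atTop hb (-((m + 2 : ℝ) / γ))).comp_tendsto
    ((tendsto_rpow_atTop hγ).comp tendsto_natCast_atTop_atTop)
  have h2 := (Asymptotics.isBigO_refl (fun k : ℕ => (k : ℝ) ^ m) Filter.atTop).mul h1.isBigO
  refine summable_of_isBigO_nat (g := fun k : ℕ => 1 / (k : ℝ) ^ 2)
    (Real.summable_one_div_nat_pow.2 one_lt_two) ?_
  refine (h2.congr_left fun k => ?_).congr' .rfl ?_
  · simp [neg_mul]
  · filter_upwards [Filter.eventually_gt_atTop 0] with k hk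
    have hk' : (0 : ℝ) < k := by exact_mod_cast hk
    simp only [Function.comp]
    rw [← Real.rpow_mul hk'.le, ← Real.rpow_natCast, ← Real.rpow_add hk', ← Real.rpow_natCast,
      one_div, ← Real.rpow_neg hk'.le]
    congr 1
    push_cast
    field_simp
    ring

/-- On `k ≥ K` one has `k * K ^ 2 ≤ k ^ 3`. The order `K ^ (-2)` is what is needed: the tail must be
small compared with the density of surviving candidates, which is of order `1 / K`. -/
theorem sum_range_ite_le {γ : ℝ} (hγ : 0 < γ) {b : ℝ} (hb : 0 < b) {K : ℕ} (hK : 0 < K) (N : ℕ) :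
    ∑ k ∈ Finset.range N, (if K ≤ k then (k : ℝ) * Real.exp (-(b * (k : ℝ) ^ γ)) else 0)
      ≤ (∑' k : ℕ, (k : ℝ) ^ 3 * Real.exp (-(b * (k : ℝ) ^ γ))) / K ^ 2 := by
  have hK' : (0 : ℝ) < K := by exact_mod_cast hK
  rw [le_div_iff₀ (by positivity), Finset.sum_mul]
  refine le_trans (Finset.sum_le_sum fun k _ => ?_)
    ((summable_pow_mul_exp_neg_rpow hγ hb 3).sum_le_tsum (Finset.range N) fun _ _ => by positivity)
  split_ifs with h
  · have h' : (K : ℝ) ≤ k := by exact_mod_cast h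
    have : (k : ℝ) * K ^ 2 ≤ k ^ 3 := by
      rw [pow_succ' (k : ℝ) 2]
      gcongr
    nlinarith [Real.exp_pos (-(b * (k : ℝ) ^ γ))]
  · rw [zero_mul]
    positivity

theorem exp_neg_two_mul_le {p : ℝ} (h₀ : 0 ≤ p) (h₁ : p ≤ 1 / 2) :
    Real.exp (-(2 * p)) ≤ 1 - p := by
  rw [Real.exp_neg, inv_le_comm₀ (Real.exp_pos _) (by linarith)]
  refine le_trans ?_ (Real.add_one_le_exp (2 * p))
  rw [inv_le_iff_one_le_mul₀ (by linarith)]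
  nlinarith

variable {γ : ℝ} {N : ℕ}

theorem edgeProb_le_half (hγ : 0 < γ) (e : LongEdge N) : (edgeProb γ e.1 : ℝ) ≤ 1 / 2 := by
  have h1 : (1 : ℝ) ≤ (e.len : ℝ) ^ γ := by
    refine Real.one_le_rpow ?_ hγ.le
    exact_mod_cast one_le_two.trans e.two_le_len
  calc (edgeProb γ e.1 : ℝ) = Real.exp (-((e.len : ℝ) ^ γ)) := rfl
    _ ≤ Real.exp (-1) := Real.exp_le_exp.2 (by linarith)
    _ ≤ 1 / 2 := by
      have := Real.exp_one_gt_d9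
      rw [Real.exp_neg, ← one_div]
      exact one_div_le_one_div_of_le (by norm_num) (by linarith)

/-- The bound is uniform in `K`, so that `K` can be chosen afterwards in terms of it. -/
theorem le_prod_shortEdges (hγ : 0 < γ) (K : ℕ) (j : Fin (N / K)) :
    Real.exp (-(2 * ∑' k : ℕ, (k : ℝ) * Real.exp (-((k : ℝ) ^ γ))))
      ≤ ∏ e ∈ shortEdges N K j, (1 - (edgeProb γ e.1 : ℝ)) := by
  have hs : Summable fun k : ℕ => (k : ℝ) * Real.exp (-((k : ℝ) ^ γ)) := by
    simpa using summable_pow_mul_exp_neg_rpow hγ one_pos 1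
  calc Real.exp (-(2 * ∑' k : ℕ, (k : ℝ) * Real.exp (-((k : ℝ) ^ γ))))
      ≤ Real.exp (∑ e ∈ shortEdges N K j, -(2 * (edgeProb γ e.1 : ℝ))) := by
        refine Real.exp_le_exp.2 ?_
        rw [Finset.sum_neg_distrib, ← Finset.mul_sum, neg_le_neg_iff]
        refine mul_le_mul_of_nonneg_left ?_ zero_le_two
        refine (sum_longEdge_cover_le (fun k => Real.exp (-((k : ℝ) ^ γ)))
          (fun _ => (Real.exp_pos _).le) (j * K) _ fun e he => (Finset.mem_filter.1 he).2.2).trans ?_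
        exact hs.sum_le_tsum _ fun _ _ => by positivity
    _ = ∏ e ∈ shortEdges N K j, Real.exp (-(2 * (edgeProb γ e.1 : ℝ))) := Real.exp_sum _ _
    _ ≤ _ := Finset.prod_le_prod (fun _ _ => (Real.exp_pos _).le) fun e _ =>
        exp_neg_two_mul_le (edgeProb γ e.1).2.1 (edgeProb_le_half hγ e)

/-- With `a` the tilted exponent, `exp a - 1 ≤ a * exp a`. Monotonicity of powers, with `t ^ (γ - 1)
≤ x ^ (γ - 1)` for `x ≤ t` and `t ^ γ ≤ x ^ γ` for `t ≤ x`, gives `a ≤ x ^ γ / 2`, so half of the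
decay survives. -/
theorem exp_neg_rpow_mul_exp_sub_one_le (hγ₀ : 0 < γ) (hγ₁ : γ < 1) {x t : ℝ} (hlen : 0 < x)
    (ht : 0 < t) :
    Real.exp (-(x ^ γ)) * (Real.exp (t ^ (γ - 1) / 2 * min x t) - 1)
      ≤ t ^ (γ - 1) / 2 * (x * Real.exp (-(1 / 2 * x ^ γ))) := by
  set s : ℝ := t ^ (γ - 1) / 2 with hs
  have hs0 : 0 < s := by positivity
  set a : ℝ := s * min x t with ha
  have ha1 : a ≤ s * x := by
    rw [ha]
    gcongr
    exact min_le_left _ _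
  have ha2 : a ≤ 1 / 2 * x ^ γ := by
    have hpow : ∀ x : ℝ, 0 < x → x ^ (γ - 1) * x = x ^ γ := fun x hx => by
      rw [Real.rpow_sub_one hx.ne', div_mul_cancel₀ _ hx.ne']
    rw [ha, hs]
    rcases le_total x t with hle | hle
    · have := Real.rpow_le_rpow_of_nonpos hlen hle (by linarith : γ - 1 ≤ 0)
      rw [min_eq_left hle]
      nlinarith [hpow _ hlen]
    · have := Real.rpow_le_rpow ht.le hle hγ₀.le
      rw [min_eq_right hle]
      nlinarith [hpow _ ht]
  have hexp : Real.exp a - 1 ≤ a * Real.exp a := by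
    have h1 := Real.add_one_le_exp (-a)
    have h2 : Real.exp (-a) * Real.exp a = 1 := by rw [← Real.exp_add]; simp
    nlinarith [Real.exp_pos a]
  calc Real.exp (-(x ^ γ)) * (Real.exp a - 1)
      ≤ Real.exp (-(x ^ γ)) * (a * Real.exp a) :=
        mul_le_mul_of_nonneg_left hexp (Real.exp_pos _).le
    _ ≤ Real.exp (-(x ^ γ)) * (s * x * Real.exp (1 / 2 * x ^ γ)) := by gcongr
    _ = s * (x * (Real.exp (-(x ^ γ)) * Real.exp (1 / 2 * x ^ γ))) := by ring
    _ = s * (x * Real.exp (-(1 / 2 * x ^ γ))) := by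
        rw [← Real.exp_add]
        ring_nf

theorem edgeLaw_real_truncatedLength_ge (hγ₀ : 0 < γ) (hγ₁ : γ < 1) {K T : ℕ} (hK : 0 < K)
    (hT : 0 < T) {δ : ℝ}
    (hδ : (∑' k : ℕ, (k : ℝ) ^ 3 * Real.exp (-(1 / 2 * (k : ℝ) ^ γ))) / K ^ 2 ≤ δ / 2) :
    (edgeLaw γ N).real {ω | δ * N ≤ truncatedLength K T ω}
      ≤ Real.exp (-(δ / 4 * (N * (T : ℝ) ^ (γ - 1)))) := by
  have hT' : (0 : ℝ) < T := by exact_mod_cast hT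
  set s : ℝ := (T : ℝ) ^ (γ - 1) / 2 with hs
  have hs0 : 0 < s := by positivity
  let a : LongEdge N → ℝ := fun e => s * if K ≤ e.len then (min e.len T : ℝ) else 0
  have hset : {ω : LongEdge N → Bool | δ * N ≤ truncatedLength K T ω}
      = {ω | s * (δ * N) ≤ ∑ e, if ω e = true then a e else 0} := by
    ext ω
    simp only [Set.mem_ofPred_eq, truncatedLength]
    rw [← mul_le_mul_iff_right₀ hs0, Finset.mul_sum]
    simp only [a, mul_ite, mul_zero]
  rw [hset]
  have hchernoff := bernoulliPi_real_le_sum (fun e : LongEdge N => edgeProb γ e.1) a (s * (δ * N))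
  refine le_trans hchernoff (Real.exp_le_exp.2 ?_)
  have hterm : ∀ e : LongEdge N, (edgeProb γ e.1 : ℝ) * (Real.exp (a e) - 1)
      ≤ s * if K ≤ e.len then (e.len : ℝ) * Real.exp (-(1 / 2 * (e.len : ℝ) ^ γ)) else 0 := by
    intro e
    by_cases h : K ≤ e.len
    · have hlen : (0 : ℝ) < e.len := by exact_mod_cast hK.trans_le h
      have ha : a e = s * min (e.len : ℝ) T := by simp only [a, if_pos h]
      rw [ha, if_pos h]
      exact exp_neg_rpow_mul_exp_sub_one_le hγ₀ hγ₁ hlen hT'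
    · have ha : a e = 0 := by simp only [a, if_neg h, mul_zero]
      rw [ha, if_neg h]
      simp
  have hsum : ∑ e : LongEdge N, (edgeProb γ e.1 : ℝ) * (Real.exp (a e) - 1)
      ≤ s * (N * (δ / 2)) := by
    refine (Finset.sum_le_sum fun e _ => hterm e).trans ?_
    rw [← Finset.mul_sum]
    refine mul_le_mul_of_nonneg_left ?_ hs0.le
    refine (sum_longEdge_le
      (fun k => if K ≤ k then (k : ℝ) * Real.exp (-(1 / 2 * (k : ℝ) ^ γ)) else 0)
      fun k => by positivity).trans ?_
    gcongr
    exact (sum_range_ite_le hγ₀ one_half_pos hK N).trans hδ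
  have : s * (δ * N) / 2 = δ / 4 * (N * (T : ℝ) ^ (γ - 1)) := by rw [hs]; ring
  linarith

theorem exists_refMeasure_real_le (hγ₀ : 0 < γ) (hγ₁ : γ < 1) :
    ∃ θ : ℝ, 0 < θ ∧ θ ≤ 1 ∧ ∃ K : ℕ, 2 ≤ K ∧ ∀ N T : ℕ, K ≤ N → 1 ≤ T → (T : ℝ) ≤ θ * N / 4 →
      (refMeasure γ N).real {g | averagePathLength g ≤ θ ^ 2 / 8 * T}
        ≤ 2 * Real.exp (-(θ / 32 * (N * (T : ℝ) ^ (γ - 1)))) := by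
  set q : ℝ := Real.exp (-(2 * ∑' k : ℕ, (k : ℝ) * Real.exp (-((k : ℝ) ^ γ)))) with hq
  set M : ℝ := ∑' k : ℕ, (k : ℝ) ^ 3 * Real.exp (-(1 / 2 * (k : ℝ) ^ γ)) with hM
  have hq0 : 0 < q := Real.exp_pos _
  have hq1 : q ≤ 1 := Real.exp_le_one_iff.2 <| neg_nonpos.2 <|
    mul_nonneg zero_le_two (tsum_nonneg fun _ => by positivity)
  -- With `θ = q / (8 * K)`, the tail condition `M / K ^ 2 ≤ θ / 16` reads `128 * M ≤ K * q`.
  obtain ⟨K, hK⟩ := exists_nat_ge (max 2 (128 * M / q))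
  have hK2 : (2 : ℝ) ≤ K := (le_max_left _ _).trans hK
  have hKM : 128 * M ≤ K * q := (div_le_iff₀ hq0).1 ((le_max_right _ _).trans hK)
  have hK2' : 2 ≤ K := by exact_mod_cast hK2
  have hθ : 0 < q / (8 * K) := by positivity
  refine ⟨q / (8 * K), hθ, ?_, K, hK2', fun N T hN hT hTN => ?_⟩
  · rw [div_le_one (by positivity)]
    linarith
  set θ := q / (8 * K) with hθq
  have hT' : (1 : ℝ) ≤ T := by exact_mod_cast hT
  -- For `N ≥ K`, rounding down `N / K` loses at most a factor `2`; this fixes the `8` in `θ`.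
  have hJ : θ * N ≤ q * (N / K : ℕ) / 4 := by
    have h1 : N ≤ N / K * K * 2 := by
      have h2 := Nat.div_add_mod' N K
      have h3 := Nat.mod_lt N (by omega : 0 < K)
      have h4 : K ≤ N / K * K := Nat.le_mul_of_pos_left K (Nat.div_pos hN (by omega))
      omega
    have h1' : (N : ℝ) ≤ (N / K : ℕ) * K * 2 := by exact_mod_cast h1
    rw [hθq, div_mul_eq_mul_div, div_le_iff₀ (by positivity)]
    nlinarith
  have hX := edgeLaw_real_truncatedLength_ge (N := N) hγ₀ hγ₁ (K := K) (T := T) (by omega)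
    (by omega) (δ := θ / 8) (by
      rw [← hM, hθq, div_le_iff₀ (by positivity)]
      have : q / (8 * K) / 8 / 2 * K ^ 2 = K * q / 128 := by field_simp; norm_num
      rw [this]
      linarith)
  have hB := bernoulliPi_real_card_le (fun e : LongEdge N => edgeProb γ e.1) (shortEdges N K)
    (disjoint_shortEdges N K) (le_prod_shortEdges hγ₀ K)
  have hsub : graphOf ⁻¹' {g : GroundedGraph N | averagePathLength g ≤ θ ^ 2 / 8 * T}
      ⊆ {ω | θ / 8 * N ≤ truncatedLength K T ω} ∪
        {ω | ((Finset.univ.filter fun j => ∀ e ∈ shortEdges N K j, ω e = false).card : ℝ)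
          ≤ q * (N / K : ℕ) / 4} := by
    intro ω hω
    by_contra h
    rw [Set.mem_union, not_or] at h
    obtain ⟨h1, h2⟩ := h
    exact absurd hω (not_le.2 (lt_averagePathLength_graphOf hK2' hT (by omega) hθ hTN ω
      (not_le.1 h1).le (hJ.trans (not_le.1 h2).le)))
  rw [refMeasure, map_measureReal_apply measurable_graphOf (Set.toFinite _).measurableSet]
  refine (measureReal_mono hsub).trans ((measureReal_union_le _ _).trans ?_)
  rw [two_mul]
  refine add_le_add (hX.trans (le_of_eq (by ring_nf))) (hB.trans (Real.exp_le_exp.2 ?_))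
  -- Hence the bound for the candidates, exponential in `N`, is no worse than the one for the
  -- truncated length.
  have hpow : (T : ℝ) ^ (γ - 1) ≤ 1 := Real.rpow_le_one_of_one_le_of_nonpos hT' (by linarith)
  have hpow0 : 0 ≤ (T : ℝ) ^ (γ - 1) := by positivity
  have : θ / 32 * (N * (T : ℝ) ^ (γ - 1)) ≤ θ * N := by
    calc θ / 32 * (N * (T : ℝ) ^ (γ - 1)) ≤ θ / 32 * (N * 1) := by gcongr
      _ ≤ θ * N := by
        have : 0 ≤ θ * N := by positivity
        linarith
  linarith

end Estimates

/-! ### Choice of the truncation level and conclusion -/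

theorem two_mul_exp_neg_le {x y : ℝ} (hx : 2 ≤ x) (hy : y ≤ x / 2) :
    2 * Real.exp (-x) ≤ Real.exp (-y) := by
  have h1 : (2 : ℝ) ≤ Real.exp (x - y) := by linarith [Real.add_one_le_exp (x - y)]
  calc 2 * Real.exp (-x) ≤ Real.exp (x - y) * Real.exp (-x) := by gcongr
    _ = Real.exp (-y) := by rw [← Real.exp_add]; ring_nf

theorem eventually_le_mul_rpow {a p : ℝ} (ha : 0 < a) (hp : 0 < p) (b : ℝ) :
    ∀ᶠ N : ℕ in Filter.atTop, b ≤ a * (N : ℝ) ^ p :=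
  (((tendsto_rpow_atTop hp).comp tendsto_natCast_atTop_atTop).const_mul_atTop ha).eventually_ge_atTop b

end SpatialGibbs

theorem proposition2p2 (γ : ℝ) (hγ₀ : 0 < γ) (hγ₁ : γ < 1) :
    (∀ α : ℝ, 0 < α → α < 1 →
      ∃ c : ℝ, 0 < c ∧ ∃ N₀ : ℕ, ∀ N : ℕ, N₀ ≤ N →
        (SpatialGibbs.refMeasure γ N).real
            {g | SpatialGibbs.averagePathLength g ≤ (N : ℝ) ^ α}
          ≤ Real.exp (-(c * (N : ℝ) ^ (1 - α * (1 - γ))))) ∧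
    (∃ c : ℝ, 0 < c ∧ ∀ N : ℕ, 2 ≤ N →
        (SpatialGibbs.refMeasure γ N).real
            {g | SpatialGibbs.averagePathLength g ≤ c * (N : ℝ)}
          ≤ Real.exp (-(c * (N : ℝ) ^ γ))) := by
  obtain ⟨θ, hθ, hθ1, K, hK, hmain⟩ := SpatialGibbs.exists_refMeasure_real_le hγ₀ hγ₁
  refine ⟨fun α hα₀ hα₁ => ?_, ?_⟩
  -- Then `T ≥ C / 2 * N ^ α` gives `θ ^ 2 / 8 * T ≥ 2 * N ^ α`, while `T ≤ C * N ^ α` controls the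
  -- exponent and keeps `T ≤ θ * N / 4` for large `N`.
  · set C : ℝ := 32 / θ ^ 2 with hC
    have hC0 : 0 < C := by positivity
    have hβ : 0 < 1 - α * (1 - γ) := by nlinarith
    have ha : 0 < θ / 32 * C ^ (γ - 1) := by positivity
    obtain ⟨N₀, hN₀⟩ := Filter.eventually_atTop.1 ((Filter.eventually_ge_atTop K).and
      ((SpatialGibbs.eventually_le_mul_rpow ha hβ 2).and
        (SpatialGibbs.eventually_le_mul_rpow (div_pos hθ four_pos) (sub_pos.2 hα₁) C)))
    refine ⟨θ / 32 * C ^ (γ - 1) / 2, by positivity, N₀, fun N hN => ?_⟩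
    obtain ⟨hKN, h1, h2⟩ := hN₀ N hN
    have hN1 : (1 : ℝ) ≤ N := by exact_mod_cast (one_le_two.trans hK).trans hKN
    have hN0 : (0 : ℝ) < N := by linarith
    have hNα : 1 ≤ (N : ℝ) ^ α := Real.one_le_rpow hN1 hα₀.le
    have hCN : 1 ≤ C / 2 * (N : ℝ) ^ α := by
      have : 1 ≤ C / 2 := by
        rw [hC, le_div_iff₀ two_pos, le_div_iff₀ (by positivity)]
        nlinarith
      nlinarith
    set T : ℕ := ⌈C / 2 * (N : ℝ) ^ α⌉₊ with hT
    have hT1 : C / 2 * (N : ℝ) ^ α ≤ T := Nat.le_ceil _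
    have hT2 : (T : ℝ) ≤ C * (N : ℝ) ^ α := by
      have := (Nat.ceil_lt_add_one (by linarith : 0 ≤ C / 2 * (N : ℝ) ^ α)).le
      linarith
    have hT3 : 1 ≤ T := by exact_mod_cast hCN.trans hT1
    have hT0 : (0 : ℝ) < T := by exact_mod_cast hT3
    have hT4 : (T : ℝ) ≤ θ * N / 4 := by
      refine hT2.trans ?_
      calc C * (N : ℝ) ^ α ≤ θ / 4 * (N : ℝ) ^ (1 - α) * (N : ℝ) ^ α := by gcongr
        _ = θ * N / 4 := by
          rw [mul_assoc, ← Real.rpow_add hN0, sub_add_cancel, Real.rpow_one]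
          ring
    have hsub : {g : SpatialGibbs.GroundedGraph N |
        SpatialGibbs.averagePathLength g ≤ (N : ℝ) ^ α}
        ⊆ {g | SpatialGibbs.averagePathLength g ≤ θ ^ 2 / 8 * T} := by
      intro g hg
      refine le_trans (show _ ≤ (N : ℝ) ^ α from hg) ?_
      have : θ ^ 2 / 8 * (C / 2 * (N : ℝ) ^ α) = 2 * (N : ℝ) ^ α := by
        rw [hC]
        field_simp
        norm_num
      have := mul_le_mul_of_nonneg_left hT1 (by positivity : 0 ≤ θ ^ 2 / 8)
      linarith
    have hexp : θ / 32 * C ^ (γ - 1) * (N : ℝ) ^ (1 - α * (1 - γ))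
        ≤ θ / 32 * (N * (T : ℝ) ^ (γ - 1)) := by
      have h3 := Real.rpow_le_rpow_of_nonpos hT0 hT2 (by linarith : γ - 1 ≤ 0)
      calc θ / 32 * C ^ (γ - 1) * (N : ℝ) ^ (1 - α * (1 - γ))
          = θ / 32 * (N * (C * (N : ℝ) ^ α) ^ (γ - 1)) := by
            rw [Real.mul_rpow hC0.le (by positivity), ← Real.rpow_mul hN0.le,
              show 1 - α * (1 - γ) = 1 + α * (γ - 1) by ring, Real.rpow_add hN0, Real.rpow_one]
            ring
        _ ≤ _ := by gcongr
    refine (measureReal_mono hsub).trans ((hmain N T hKN hT3 hT4).trans ?_)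
    exact SpatialGibbs.two_mul_exp_neg_le (h1.trans hexp) (by linarith)
  · obtain ⟨N₁, hN₁⟩ := Filter.eventually_atTop.1 ((Filter.eventually_ge_atTop K).and
      ((SpatialGibbs.eventually_le_mul_rpow (by positivity : 0 < θ / 32) hγ₀ 2).and
        (SpatialGibbs.eventually_le_mul_rpow (div_pos hθ four_pos) one_pos 1)))
    -- The first term serves the inclusion of events with `T ≥ θ * N / 8`, the second absorbs the
    -- factor `2` of the union bound, and the third makes the event empty for `N < N₁`, as then `c *
    -- N ≤ 1 / 4`.
    refine ⟨min (θ ^ 3 / 64) (min (θ / 64) (1 / (4 * (N₁ + 1)))), by positivity, fun N hN => ?_⟩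
    set c : ℝ := min (θ ^ 3 / 64) (min (θ / 64) (1 / (4 * (N₁ + 1)))) with hc
    have hc1 : c ≤ θ ^ 3 / 64 := min_le_left _ _
    have hc2 : c ≤ θ / 64 := (min_le_right _ _).trans (min_le_left _ _)
    have hc3 : c ≤ 1 / (4 * (N₁ + 1)) := (min_le_right _ _).trans (min_le_right _ _)
    have hN0 : (0 : ℝ) < N := by exact_mod_cast (by omega : 0 < N)
    rcases lt_or_ge N N₁ with hlt | hge
    · have hempty : {g : SpatialGibbs.GroundedGraph N |
          SpatialGibbs.averagePathLength g ≤ c * (N : ℝ)} = ∅ := by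
        refine Set.eq_empty_of_forall_notMem fun g hg => ?_
        have h1 : SpatialGibbs.averagePathLength g ≤ c * N := hg
        have h2 := SpatialGibbs.half_le_averagePathLength hN g
        have h3 : (N : ℝ) < N₁ := by exact_mod_cast hlt
        have h4 : c * N ≤ 1 / (4 * (N₁ + 1)) * (N₁ + 1) := by gcongr; linarith
        have h5 : 1 / (4 * ((N₁ : ℝ) + 1)) * (N₁ + 1) = 1 / 4 := by field_simp
        linarith
      rw [hempty, measureReal_empty]
      exact (Real.exp_pos _).le
    · obtain ⟨hKN, h1, h2⟩ := hN₁ N hge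
      rw [Real.rpow_one] at h2
      set T : ℕ := ⌊θ * N / 4⌋₊ with hT
      have hT4 : (T : ℝ) ≤ θ * N / 4 := Nat.floor_le (by positivity)
      have hT3 : 1 ≤ T := Nat.le_floor (by push_cast; linarith)
      have hT3' : (1 : ℝ) ≤ T := by exact_mod_cast hT3
      have hT0 : (0 : ℝ) < T := by linarith
      have hT1 : θ * N / 8 ≤ T := by
        have := Nat.lt_floor_add_one (θ * N / 4)
        rw [← hT] at this
        linarith
      have hTN : (T : ℝ) ≤ N := by nlinarith
      have hsub : {g : SpatialGibbs.GroundedGraph N |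
          SpatialGibbs.averagePathLength g ≤ c * (N : ℝ)}
          ⊆ {g | SpatialGibbs.averagePathLength g ≤ θ ^ 2 / 8 * T} := by
        intro g hg
        refine le_trans (show _ ≤ c * (N : ℝ) from hg) ?_
        calc c * (N : ℝ) ≤ θ ^ 3 / 64 * N := by gcongr
          _ = θ ^ 2 / 8 * (θ * N / 8) := by ring
          _ ≤ _ := by gcongr
      have hexp : θ / 32 * (N : ℝ) ^ γ ≤ θ / 32 * (N * (T : ℝ) ^ (γ - 1)) := by
        have h3 := Real.rpow_le_rpow_of_nonpos hT0 hTN (by linarith : γ - 1 ≤ 0)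
        calc θ / 32 * (N : ℝ) ^ γ = θ / 32 * (N * (N : ℝ) ^ (γ - 1)) := by
              rw [Real.rpow_sub_one hN0.ne', mul_div_cancel₀ _ hN0.ne']
          _ ≤ _ := by gcongr
      refine (measureReal_mono hsub).trans ((hmain N T hKN hT3 hT4).trans ?_)
      refine SpatialGibbs.two_mul_exp_neg_le (h1.trans hexp) ?_
      have : c * (N : ℝ) ^ γ ≤ θ / 64 * (N : ℝ) ^ γ := by gcongr
      linarith
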